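/- Let $\mathcal{X}$ be a smooth absolutely irreducible projective curve over a finite field $\mathbb{F}$, let $P_1,\dots,P_n,Q$ be distinct rational points of $\mathcal{X}$, and let $D=P_1+\cdots+P_n$. For an integer $a$ let $L(aQ)$ be the Riemann–Roch space of the divisor $aQ$ and let $$C_L(D,aQ)=\{(f(P_1),\dots,f(P_n)) : f\in L(aQ)\}\subseteq\mathbb{F}^n$$ be the corresponding one-point code. For $i=1,\dots,n$ let $m_i$ be the minimal integer such that $\dim C_L(D,m_iQ)=i$ (so that $0<C_L(D,m_1Q)<\cdots<C_L(D,m_nQ)=\mathbb{F}^n$ is the complete flag of one-point codes), and let $W^*=\{m_1,\dots,m_n\}$ be the set of geometric nongaps. Let $W\subseteq\mathbb{N}_0$ be the Weierstrass semigroup at $Q$, i.e. the set of all pole orders at $Q$ of nonzero rational functions on $\mathcal{X}$ that are regular outside $Q$. Then $W\setminus W^*$ is an ideal of $W$; that is, for all $a\in W\setminus W^*$ and $b\in W$ one has $a+b\in W\setminus W^*$. No lower bound on $n$ in terms of the genus is assumed. -/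

import Mathlib

universe u

open AlgebraicGeometry CategoryTheory
open scoped Polynomial

/-- In a standard smooth algebra of relative dimension one over a field, the maximal ideal of every
local ring is principal. -/
theorem isPrincipal_maximalIdeal_of_isStandardSmooth (F S L : Type u) [Field F] [CommRing S] [Algebra F S]
    [Algebra.IsStandardSmoothOfRelativeDimension 1 F S] (q : Ideal S) [q.IsPrime]
    [CommRing L] [Algebra S L] [IsLocalization.AtPrime L q] [IsLocalRing L] :
    (IsLocalRing.maximalIdeal L).IsPrincipal := by
  have : Nontrivial S :=
    ⟨0, 1, fun h => ‹q.IsPrime›.ne_top ((Ideal.eq_top_iff_one q).2 (h ▸ q.zero_mem))⟩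
  have hss : Algebra.IsStandardSmooth F S :=
    Algebra.IsStandardSmoothOfRelativeDimension.isStandardSmooth 1
  obtain ⟨-, I, b, hb⟩ := Algebra.IsStandardSmooth.iff_exists_basis_kaehlerDifferential.1 hss
  have hr := Algebra.IsStandardSmoothOfRelativeDimension.rank_kaehlerDifferential
    (R := F) (S := S) (n := 1)
  have hI : Cardinal.mk I = 1 := by
    have := b.mk_eq_rank
    rw [hr] at this
    simpa using this
  obtain ⟨hsub, ⟨i⟩⟩ := Cardinal.eq_one_iff_unique.1 hI
  obtain ⟨t, ht⟩ := hb ⟨i, rfl⟩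
  let φ : F[X] →ₐ[F] S := Polynomial.aeval t
  let _ : Algebra F[X] S := φ.toRingHom.toAlgebra
  have : IsScalarTower F F[X] S := IsScalarTower.of_algebraMap_eq' φ.comp_algebraMap.symm
  have hX : algebraMap F[X] S Polynomial.X = t := by
    change Polynomial.aeval t Polynomial.X = t
    simp
  have : Subsingleton (Ω[S⁄F[X]]) := by
    refine subsingleton_of_forall_eq 0 fun y => ?_
    obtain ⟨w, rfl⟩ := KaehlerDifferential.map_surjective F F[X] S y
    have : Fintype I := Fintype.ofSubsingleton i
    rw [← b.sum_repr w, Fintype.sum_subsingleton _ i, ← ht, map_smul, KaehlerDifferential.map_D,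
      ← hX]
    simp
  have : Algebra.FormallyUnramified F[X] S := ⟨inferInstance⟩
  have : Algebra.EssFiniteType F[X] S := .of_comp F _ _
  let p := q.comap (algebraMap F[X] S)
  have : q.LiesOver p := ⟨rfl⟩
  let _ := Localization.AtPrime.algebraOfLiesOver p q
  have hm := ((Algebra.isUnramifiedAt_iff_map_eq F[X] p q).1 inferInstance).2
  have h1 : (IsLocalRing.maximalIdeal (Localization.AtPrime q)).IsPrincipal := by
    rw [← hm]
    infer_instance
  rw [← IsLocalRing.map_ringEquiv_maximalIdeal
    (IsLocalization.algEquiv q.primeCompl (Localization.AtPrime q) L).toRingEquiv]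
  exact Submodule.IsPrincipal.map_ringHom _ h1

/-- A smooth absolutely irreducible projective curve over the field `F`. (A curve over a field is
projective if and only if it is proper, and for a smooth scheme over a field, absolutely irreducible
is the same as geometrically integral.) -/
structure SmoothProjectiveCurve (F : Type u) [Field F] where
  X : Scheme.{u}
  π : X ⟶ Spec (.of F)
  smooth : SmoothOfRelativeDimension 1 π
  proper : IsProper π
  geometricallyIntegral : GeometricallyIntegral π

namespace SmoothProjectiveCurve
variable {F : Type u} [Field F] (C : SmoothProjectiveCurve F)

instance : IsIntegral C.X :=
  have := C.geometricallyIntegral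
  GeometricallyIntegral.isIntegral_of_subsingleton C.π

instance : IsLocallyNoetherian C.X :=
  have := C.proper
  LocallyOfFiniteType.isLocallyNoetherian C.π

theorem isPrincipalIdealRing_stalk (x : C.X) : IsPrincipalIdealRing (C.X.presheaf.stalk x) := by
  obtain ⟨U, hU, V, hV, hx, e, h⟩ := C.smooth.exists_isStandardSmoothOfRelativeDimension x
  have hUt : U = ⊤ := by
    refine top_unique fun y _ => ?_
    rw [Subsingleton.elim y (C.π x)]
    exact e hx
  have hF : IsField Γ(Spec (.of F), U) := by
    subst hUt
    exact MulEquiv.isField (Field.toIsField F)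
      (Scheme.ΓSpecIso (.of F)).commRingCatIsoToRingEquiv.toMulEquiv
  let _ := hF.toField
  let _ := (C.π.appLE U V e).hom.toAlgebra
  have : Algebra.IsStandardSmoothOfRelativeDimension 1 Γ(Spec (.of F), U) Γ(C.X, V) := h
  let y : V := ⟨x, hx⟩
  let _ := TopCat.Presheaf.algebra_section_stalk C.X.presheaf y
  have := hV.isLocalization_stalk y
  have := isPrincipal_maximalIdeal_of_isStandardSmooth Γ(Spec (.of F), U) Γ(C.X, V) (C.X.presheaf.stalk x)
    (hV.primeIdealOf y).asIdeal
  exact ((tfae_of_isNoetherianRing_of_isLocalRing_of_isDomain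
    (C.X.presheaf.stalk x)).out 4 0).1 this

/-- The local rings of the closed points are discrete valuation rings. -/
theorem isDiscreteValuationRing_stalk {x : C.X} (hx : Order.coheight x = 1) :
    IsDiscreteValuationRing (C.X.presheaf.stalk x) := by
  have := C.isPrincipalIdealRing_stalk x
  have h := ringKrullDim_stalk_eq_coheight x
  refine ⟨fun hb => ?_⟩
  have := ringKrullDim_eq_zero_of_isField (IsLocalRing.isField_iff_maximalIdeal_eq.2 hb)
  rw [this, hx] at h
  exact absurd h (by decide)

/-- The local rings, in particular the function field, are algebras over the base field through the
structure morphism. -/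
noncomputable instance (x : C.X) : Algebra F (C.X.presheaf.stalk x) :=
  (CommRingCat.Hom.hom ((Scheme.ΓSpecIso (.of F)).inv ≫ C.π.appTop ≫
    C.X.presheaf.germ ⊤ x trivial)).toAlgebra

instance (x : C.X) : IsScalarTower F (C.X.presheaf.stalk x) C.X.functionField := by
  refine IsScalarTower.of_algebraMap_eq' ?_
  simp only [RingHom.algebraMap_toAlgebra]
  rw [← CommRingCat.hom_comp]
  simp only [Category.assoc]
  congr 3
  exact (C.X.presheaf.germ_stalkSpecializes (U := ⊤) trivial _).symm

theorem coheight_eq_one_or_isField (x : C.X) :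
    Order.coheight x = 1 ∨ IsField (C.X.presheaf.stalk x) := by
  by_cases h : IsField (C.X.presheaf.stalk x)
  · exact .inr h
  · have := C.isPrincipalIdealRing_stalk x
    have h1 := IsPrincipalIdealRing.ringKrullDim_eq_one (C.X.presheaf.stalk x) h
    rw [ringKrullDim_stalk_eq_coheight] at h1
    exact .inl (by exact_mod_cast h1)

theorem ord_algebraMap {x : C.X} {c : F} (hc : c ≠ 0) :
    C.X.ord (algebraMap F C.X.functionField c) x = 0 :=
  have : Nonempty (⊤ : C.X.Opens) := ⟨⟨x, trivial⟩⟩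
  Scheme.ord_of_isUnit (U := ⊤)
    (((isUnit_iff_ne_zero.2 hc).map (Scheme.ΓSpecIso (.of F)).inv.hom).map C.π.appTop.hom) trivial

/-- The Riemann--Roch space `L(G) = {f | f = 0 or div f + G ≥ 0}` of a divisor `G`. The codimension
one points of the curve are its closed points, and `ord f z` is the order of vanishing. -/
noncomputable def riemannRochSpace (G : C.X →₀ ℤ) : Submodule F C.X.functionField where
  carrier := {f | f = 0 ∨ ∀ z : C.X, Order.coheight z = 1 → 0 ≤ C.X.ord f z + G z}
  zero_mem' := .inl rfl
  add_mem' := by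
    intro f g hf hg
    rcases hf with rfl | hf
    · simpa using hg
    rcases hg with rfl | hg
    · simpa using Or.inr hf
    by_cases hfg : f + g = 0
    · exact .inl hfg
    · refine .inr fun z hz => ?_
      have := C.isDiscreteValuationRing_stalk hz
      have h1 := Scheme.ord_add (x := z) hfg
      have := hf z hz
      have := hg z hz
      rcases min_le_iff.1 h1 <;> omega
  smul_mem' := by
    intro c f hf
    by_cases hc : c = 0
    · exact .inl (by simp [hc])
    rcases hf with rfl | hf
    · exact .inl (smul_zero c)
    by_cases hf0 : f = 0
    · exact .inl (by simp [hf0])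
    · refine .inr fun z hz => ?_
      rw [Algebra.smul_def, Scheme.ord_mul (by simpa using hc) hf0, C.ord_algebraMap hc, zero_add]
      exact hf z hz

/-- A function in `L(G)` is regular outside the support of `G`. -/
theorem exists_algebraMap_eq {G : C.X →₀ ℤ} {f : C.X.functionField}
    (hf : f ∈ C.riemannRochSpace G) {x : C.X} (hx : G x = 0) :
    ∃ h : C.X.presheaf.stalk x, algebraMap _ C.X.functionField h = f := by
  rcases C.coheight_eq_one_or_isField x with h1 | hfld
  · rcases hf with rfl | hf
    · exact ⟨0, map_zero _⟩
    by_cases hf0 : f = 0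
    · exact ⟨0, by rw [map_zero, hf0]⟩
    have := C.isDiscreteValuationRing_stalk h1
    have h2 := hf x h1
    rw [hx, add_zero, Scheme.le_ord_iff h1 hf0] at h2
    apply IsDiscreteValuationRing.exists_lift_of_le_one
    have h3 : (1 : WithZero (Multiplicative ℤ)) ≤ Ring.ordFrac (C.X.presheaf.stalk x) f := h2
    rw [Ring.ordFrac_eq_valuation_inv] at h3
    exact (one_le_inv₀ (zero_lt_iff.2 (by simpa using hf0))).1 h3
  · exact IsFractionRing.surjective_iff_isField.2 hfld f

/-- A rational point: a point whose residue field is the base field. -/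
@[ext]
structure RationalPoint where
  pt : C.X
  bijective : Function.Bijective
    ((C.X.residue pt).hom.comp (algebraMap F (C.X.presheaf.stalk pt)))

variable {C}

/-- The value at `P` of a germ of a regular function at `P`. -/
noncomputable def RationalPoint.germValue (P : C.RationalPoint) :
    C.X.presheaf.stalk P.pt →ₐ[F] F where
  toRingHom := (RingEquiv.ofBijective _ P.bijective).symm.toRingHom.comp (C.X.residue P.pt).hom
  commutes' c := (RingEquiv.ofBijective _ P.bijective).symm_apply_apply c

/-- The functions on the curve that are regular at the point `x`. -/
noncomputable def regularFunctions (x : C.X) : Subalgebra F C.X.functionField :=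
  (IsScalarTower.toAlgHom F (C.X.presheaf.stalk x) C.X.functionField).range

/-- Evaluation `f ↦ f(P)` of the functions that are regular at `P`. -/
noncomputable def RationalPoint.value (P : C.RationalPoint) : regularFunctions P.pt →ₐ[F] F :=
  P.germValue.comp (AlgEquiv.ofInjective
    (IsScalarTower.toAlgHom F (C.X.presheaf.stalk P.pt) C.X.functionField)
    (IsFractionRing.injective _ _)).symm.toAlgHom

/-- The evaluation map `ev_D : L(G) → Fⁿ`, `f ↦ (f(P₁), …, f(Pₙ))`, for a divisor `G` whose support
is disjoint from `D = P₁ + ⋯ + Pₙ`. -/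
noncomputable def evalMap {n : ℕ} (P : Fin n → C.RationalPoint) (G : C.X →₀ ℤ)
    (hG : ∀ i, G (P i).pt = 0) : C.riemannRochSpace G →ₗ[F] (Fin n → F) :=
  LinearMap.pi fun i => (P i).value.toLinearMap ∘ₗ
    Submodule.inclusion (p' := Subalgebra.toSubmodule (regularFunctions (P i).pt))
      (fun _ hf => C.exists_algebraMap_eq hf (hG i))

/-- The algebraic geometry code `C_L(D, G)`. -/
noncomputable def agCode {n : ℕ} (P : Fin n → C.RationalPoint) (G : C.X →₀ ℤ)
    (hG : ∀ i, G (P i).pt = 0) : Submodule F (Fin n → F) :=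
  LinearMap.range (evalMap P G hG)

/-- The one-point code `C_L(D, aQ)`. -/
noncomputable def onePointCode {n : ℕ} (P : Fin n → C.RationalPoint) (Q : C.RationalPoint)
    (hQ : ∀ i, P i ≠ Q) (a : ℤ) : Submodule F (Fin n → F) :=
  agCode P (Finsupp.single Q.pt a)
    fun i => Finsupp.single_eq_of_ne fun h => hQ i (RationalPoint.ext h)

/-- The set `W* = {m₁, …, mₙ}` of geometric nongaps: `mᵢ` is the minimal integer `b` such that
`dim C_L(D, bQ) = i`, so that the `C_L(D, mᵢQ)` form the complete flag of one-point codes. (The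
`mᵢ` are nonnegative since `L(bQ) = 0` for `b < 0`.) -/
def geometricNongaps {n : ℕ} (P : Fin n → C.RationalPoint) (Q : C.RationalPoint)
    (hQ : ∀ i, P i ≠ Q) : Set ℕ :=
  {a | ∃ i : ℕ, 1 ≤ i ∧ i ≤ n ∧
    IsLeast {b : ℤ | Module.finrank F (onePointCode P Q hQ b) = i} (a : ℤ)}

/-- The Weierstrass semigroup `W` at `Q`: the pole orders at `Q` of the functions that have no pole
outside `Q`. -/
def weierstrassSemigroup (Q : C.RationalPoint) : AddSubmonoid ℕ where
  carrier := {a | ∃ f : C.X.functionField, f ≠ 0 ∧ C.X.ord f Q.pt = -(a : ℤ) ∧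
    ∀ z : C.X, Order.coheight z = 1 → z ≠ Q.pt → 0 ≤ C.X.ord f z}
  zero_mem' := by
    have h (z : C.X) : C.X.ord (1 : C.X.functionField) z = 0 := by
      simpa using C.ord_algebraMap (x := z) (one_ne_zero (α := F))
    exact ⟨1, one_ne_zero, by simp [h], fun z _ _ => (h z).ge⟩
  add_mem' := by
    rintro a b ⟨f, hf, hfa, hf'⟩ ⟨g, hg, hgb, hg'⟩
    refine ⟨f * g, mul_ne_zero hf hg, ?_, fun z hz hzQ => ?_⟩
    · rw [Scheme.ord_mul hf hg, hfa, hgb]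
      push_cast
      ring
    · rw [Scheme.ord_mul hf hg]
      exact add_nonneg (hf' z hz hzQ) (hg' z hz hzQ)

end SmoothProjectiveCurve

/-- An ideal of a semigroup `S` of natural numbers: a subset `I` of `S` with `I + S ⊆ I`. -/
def IsSemigroupIdeal (S : AddSubmonoid ℕ) (I : Set ℕ) : Prop :=
  I ⊆ S ∧ ∀ i ∈ I, ∀ s ∈ S, i + s ∈ I

namespace SmoothProjectiveCurve
variable {F : Type u} [Field F] {C : SmoothProjectiveCurve F}

/-! Compare consecutive codes in the one-point filtration: `a` is a geometric nongap exactly when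
the code jumps from index `a - 1` to `a`. For `a` in the Weierstrass semigroup, there is no jump at
`a` exactly when some function with its only pole at `Q`, of order exactly `a`, vanishes at every `P
i`. One direction subtracts from a function of pole order `a` one in `L((a - 1)Q)` with the same
values. The other cancels leading terms at `Q` by scalar multiples of the vanishing function, which
leaves the codewords unchanged; it needs `Q` rational. The vanishing criterion is visibly stable
under multiplication by a function of pole order `b` with no other pole: pole orders at `Q` add and
the zeros at the `P i` remain. No genus or degree enters. -/

/-! ### Local analysis at a closed point. -/

/-- A function without a pole at the closed point `x` is regular at `x`. -/
theorem exists_algebraMap_eq_of_ord_nonneg {x : C.X} (hx : Order.coheight x = 1)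
    {f : C.X.functionField} (hf : 0 ≤ C.X.ord f x) :
    ∃ h : C.X.presheaf.stalk x, algebraMap _ C.X.functionField h = f := by
  by_cases hf0 : f = 0
  · exact ⟨0, by rw [map_zero, hf0]⟩
  have := C.isDiscreteValuationRing_stalk hx
  rw [Scheme.le_ord_iff hx hf0] at hf
  apply IsDiscreteValuationRing.exists_lift_of_le_one
  have h3 : (1 : WithZero (Multiplicative ℤ)) ≤ Ring.ordFrac (C.X.presheaf.stalk x) f := hf
  rw [Ring.ordFrac_eq_valuation_inv] at h3
  exact (one_le_inv₀ (zero_lt_iff.2 (by simpa using hf0))).1 h3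

/-- A nonzero germ in the maximal ideal has positive order. -/
theorem ord_algebraMap_pos {x : C.X} (hx : Order.coheight x = 1) {h : C.X.presheaf.stalk x}
    (h0 : h ≠ 0) (hu : ¬ IsUnit h) : 0 < C.X.ord (algebraMap _ C.X.functionField h) x := by
  by_contra! hle
  have hf0 : algebraMap _ C.X.functionField h ≠ 0 :=
    (map_ne_zero_iff _ (IsFractionRing.injective _ _)).2 h0
  have hinv := Scheme.ord_mul (x := x) hf0 (inv_ne_zero hf0)
  have h1 : C.X.ord (1 : C.X.functionField) x = 0 := by
    simpa using C.ord_algebraMap (x := x) (one_ne_zero (α := F))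
  rw [mul_inv_cancel₀ hf0, h1] at hinv
  -- With order at most zero, the inverse would be regular too, making `h` a unit.
  obtain ⟨k, hk⟩ := exists_algebraMap_eq_of_ord_nonneg hx
    (f := (algebraMap _ C.X.functionField h)⁻¹) (by omega)
  refine hu (IsUnit.of_mul_eq_one k (IsFractionRing.injective _ C.X.functionField ?_))
  rw [map_mul, hk, mul_inv_cancel₀ hf0, map_one]

/-- At a rational point, the leading term of a function can be cancelled by a scalar multiple of any
function of at most the same order. -/
theorem RationalPoint.exists_ord_sub_smul (Q : C.RationalPoint) (hQ : Order.coheight Q.pt = 1)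
    {u v : C.X.functionField} (hu : u ≠ 0) (hv : v ≠ 0) (huv : C.X.ord v Q.pt ≤ C.X.ord u Q.pt) :
    ∃ c : F, u - c • v = 0 ∨ C.X.ord v Q.pt < C.X.ord (u - c • v) Q.pt := by
  have hw : u / v ≠ 0 := div_ne_zero hu hv
  have h1 := Scheme.ord_mul (x := Q.pt) hw hv
  rw [div_mul_cancel₀ u hv] at h1
  obtain ⟨h, hh⟩ := exists_algebraMap_eq_of_ord_nonneg hQ (f := u / v) (by omega)
  -- The scalar is the value of `u / v` at `Q`, in `F` because `Q` is rational; subtracting it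
  -- leaves a germ `k` in the maximal ideal.
  refine ⟨Q.germValue h, ?_⟩
  set k := h - algebraMap F _ (Q.germValue h) with hk
  have hval : Q.germValue k = 0 := by
    rw [hk, map_sub, AlgHom.commutes]
    exact sub_self _
  have hkv : u - Q.germValue h • v = algebraMap _ C.X.functionField k * v := by
    rw [hk, map_sub, hh, sub_mul, div_mul_cancel₀ u hv, Algebra.smul_def,
      ← IsScalarTower.algebraMap_apply]
  rw [hkv]
  by_cases hk0 : k = 0
  · exact .inl (by rw [hk0, map_zero, zero_mul])
  · right
    have hpos := ord_algebraMap_pos hQ hk0 fun hunit => (hunit.map Q.germValue).ne_zero hval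
    rw [Scheme.ord_mul ((map_ne_zero_iff _ (IsFractionRing.injective _ _)).2 hk0) hv]
    omega

/-! ### Riemann–Roch spaces. -/

theorem mem_riemannRochSpace {G : C.X →₀ ℤ} {f : C.X.functionField} :
    f ∈ C.riemannRochSpace G ↔
      f = 0 ∨ ∀ z : C.X, Order.coheight z = 1 → 0 ≤ C.X.ord f z + G z :=
  Iff.rfl

theorem riemannRochSpace_mono {G H : C.X →₀ ℤ} (h : G ≤ H) :
    C.riemannRochSpace G ≤ C.riemannRochSpace H := by
  rintro f (rfl | hf)
  · exact zero_mem _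
  · exact .inr fun z hz => (hf z hz).trans (by gcongr; exact h z)

theorem mul_mem_riemannRochSpace {G H : C.X →₀ ℤ} {f g : C.X.functionField}
    (hf : f ∈ C.riemannRochSpace G) (hg : g ∈ C.riemannRochSpace H) :
    f * g ∈ C.riemannRochSpace (G + H) := by
  by_cases hf0 : f = 0
  · rw [hf0, zero_mul]; exact zero_mem _
  by_cases hg0 : g = 0
  · rw [hg0, mul_zero]; exact zero_mem _
  refine .inr fun z hz => ?_
  have h1 := (mem_riemannRochSpace.1 hf).resolve_left hf0 z hz
  have h2 := (mem_riemannRochSpace.1 hg).resolve_left hg0 z hz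
  rw [Scheme.ord_mul hf0 hg0, Finsupp.add_apply]
  omega

theorem mem_riemannRochSpace_single {x : C.X} {a : ℤ} {f : C.X.functionField} (hf : f ≠ 0) :
    f ∈ C.riemannRochSpace (Finsupp.single x a) ↔
      (Order.coheight x = 1 → -a ≤ C.X.ord f x) ∧
        ∀ z : C.X, Order.coheight z = 1 → z ≠ x → 0 ≤ C.X.ord f z := by
  rw [mem_riemannRochSpace]
  constructor
  · intro h
    replace h := h.resolve_left hf
    refine ⟨fun hx => ?_, fun z hz hzx => ?_⟩
    · have := h x hx
      rw [Finsupp.single_eq_same] at this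
      omega
    · simpa [Finsupp.single_eq_of_ne hzx] using h z hz
  · rintro ⟨hx, h⟩
    refine .inr fun z hz => ?_
    by_cases hzx : z = x
    · subst hzx
      rw [Finsupp.single_eq_same]
      have := hx hz
      omega
    · simpa [Finsupp.single_eq_of_ne hzx] using h z hz hzx

/-! ### Jumps of the one-point codes. -/

section Codes

variable {n : ℕ} {P : Fin n → C.RationalPoint} {Q : C.RationalPoint}

/-- Evaluation at each point is an algebra homomorphism and does not see the divisor, so `K` need
not be `G + H`. -/
theorem evalMap_mul {G H K : C.X →₀ ℤ} (hG : ∀ i, G (P i).pt = 0) (hH : ∀ i, H (P i).pt = 0)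
    (hK : ∀ i, K (P i).pt = 0) {f g : C.X.functionField} (hf : f ∈ C.riemannRochSpace G)
    (hg : g ∈ C.riemannRochSpace H) (hfg : f * g ∈ C.riemannRochSpace K) :
    evalMap P K hK ⟨f * g, hfg⟩ = evalMap P G hG ⟨f, hf⟩ * evalMap P H hH ⟨g, hg⟩ := by
  funext i
  exact map_mul (P i).value ⟨f, C.exists_algebraMap_eq hf (hG i)⟩
    ⟨g, C.exists_algebraMap_eq hg (hH i)⟩

theorem agCode_mono {G H : C.X →₀ ℤ} (hG : ∀ i, G (P i).pt = 0) (hH : ∀ i, H (P i).pt = 0)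
    (h : C.riemannRochSpace G ≤ C.riemannRochSpace H) : agCode P G hG ≤ agCode P H hH := by
  rintro _ ⟨⟨f, hf⟩, rfl⟩
  exact ⟨⟨f, h hf⟩, rfl⟩

theorem onePointCode_mono (hQ : ∀ i, P i ≠ Q) : Monotone (onePointCode P Q hQ) :=
  fun _ _ hab => agCode_mono _ _ (riemannRochSpace_mono (Finsupp.single_mono hab))

/-- The one-point code jumps at each geometric nongap. -/
theorem onePointCode_ne_of_mem_geometricNongaps {hQ : ∀ i, P i ≠ Q} {a : ℕ}
    (ha : a ∈ geometricNongaps P Q hQ) :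
    onePointCode P Q hQ (a - 1) ≠ onePointCode P Q hQ a := by
  obtain ⟨i, -, -, hi, hmin⟩ := ha
  intro h
  -- The subtraction is in `ℤ`, so `a = 0` is compared with index `-1`.
  have := hmin (a := (a : ℤ) - 1) (by rw [Set.mem_ofPred_eq, h]; exact hi)
  omega

/-- The one-point code does not jump outside the set of geometric nongaps. -/
theorem onePointCode_eq_of_notMem_geometricNongaps {hQ : ∀ i, P i ≠ Q} {a : ℕ}
    (ha : a ∉ geometricNongaps P Q hQ) :
    onePointCode P Q hQ (a - 1) = onePointCode P Q hQ a := by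
  have hmono := onePointCode_mono hQ
  refine Submodule.eq_of_le_of_finrank_le (hmono (by omega)) ?_
  by_contra! hlt
  -- A strict rise makes the dimension at `a` positive, and by monotonicity no smaller index attains
  -- it.
  refine ha ⟨Module.finrank F (onePointCode P Q hQ a), by omega, ?_, rfl, fun b hb => ?_⟩
  · simpa using Submodule.finrank_le (onePointCode P Q hQ a)
  · by_contra! hba
    have h1 := Submodule.finrank_mono (hmono (show b ≤ (a : ℤ) - 1 by omega))
    rw [Set.mem_ofPred_eq] at hb
    omega

/-- Orders are tested only at points of coheight one, so otherwise the coefficient at `Q` imposes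
nothing. This disposes of a degenerate case without computing the coheight of a rational point. -/
theorem onePointCode_eq_of_coheight_ne_one (hQ : ∀ i, P i ≠ Q) (hcoh : Order.coheight Q.pt ≠ 1)
    (a b : ℤ) : onePointCode P Q hQ a = onePointCode P Q hQ b := by
  have hle (a b : ℤ) : onePointCode P Q hQ a ≤ onePointCode P Q hQ b := by
    refine agCode_mono _ _ fun u hu => ?_
    by_cases hu0 : u = 0
    · rw [hu0]
      exact zero_mem _
    · rw [mem_riemannRochSpace_single hu0] at hu ⊢
      exact ⟨fun h => absurd h hcoh, hu.2⟩
  exact (hle a b).antisymm (hle b a)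

/-- If a function of pole order exactly `a` at `Q` evaluates to zero, then the one-point code does
not jump at `a`. -/
theorem onePointCode_le_of_evalMap_eq_zero (hQ : ∀ i, P i ≠ Q) (hcoh : Order.coheight Q.pt = 1)
    {a : ℤ} {f : C.X.functionField} (hf0 : f ≠ 0) (hfa : C.X.ord f Q.pt = -a)
    (hf : f ∈ C.riemannRochSpace (Finsupp.single Q.pt a))
    (hG : ∀ i, Finsupp.single Q.pt a (P i).pt = 0)
    (hev : evalMap P (Finsupp.single Q.pt a) hG ⟨f, hf⟩ = 0) :
    onePointCode P Q hQ a ≤ onePointCode P Q hQ (a - 1) := by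
  rintro _ ⟨⟨u, hu⟩, rfl⟩
  by_cases hu0 : u = 0
  · subst hu0
    exact (map_zero (evalMap P (Finsupp.single Q.pt a) hG)).symm ▸ zero_mem _
  obtain ⟨c, hc⟩ := Q.exists_ord_sub_smul hcoh hu0 hf0
    (by rw [hfa]; exact ((mem_riemannRochSpace_single hu0).1 hu).1 hcoh)
  have hmem := sub_mem hu (Submodule.smul_mem _ c hf)
  have hmem' : u - c • f ∈ C.riemannRochSpace (Finsupp.single Q.pt (a - 1)) := by
    by_cases h0 : u - c • f = 0
    · rw [h0]
      exact zero_mem _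
    · rw [mem_riemannRochSpace_single h0] at hmem ⊢
      have := hc.resolve_left h0
      exact ⟨fun _ => by omega, hmem.2⟩
  refine ⟨⟨u - c • f, hmem'⟩, ?_⟩
  change evalMap P (Finsupp.single Q.pt a) hG (⟨u, hu⟩ - c • ⟨f, hf⟩) = _
  rw [map_sub, map_smul, hev, smul_zero, sub_zero]

/-- If the one-point code does not jump at the pole order `a` of a function `f` in `L(aQ)`, then some
function in `L(aQ)` of pole order exactly `a` at `Q` evaluates to zero. -/
theorem exists_evalMap_eq_zero (hQ : ∀ i, P i ≠ Q) (hcoh : Order.coheight Q.pt = 1) {a : ℤ}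
    (hle : onePointCode P Q hQ a ≤ onePointCode P Q hQ (a - 1)) {f : C.X.functionField}
    (hf0 : f ≠ 0) (hfa : C.X.ord f Q.pt = -a)
    (hf : f ∈ C.riemannRochSpace (Finsupp.single Q.pt a))
    (hG : ∀ i, Finsupp.single Q.pt a (P i).pt = 0) :
    ∃ h : C.X.functionField, h ≠ 0 ∧ C.X.ord h Q.pt = -a ∧
      ∃ hh : h ∈ C.riemannRochSpace (Finsupp.single Q.pt a),
        evalMap P (Finsupp.single Q.pt a) hG ⟨h, hh⟩ = 0 := by
  obtain ⟨⟨g, hg⟩, hgf⟩ := hle ⟨⟨f, hf⟩, rfl⟩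
  have hg' : g ∈ C.riemannRochSpace (Finsupp.single Q.pt a) :=
    riemannRochSpace_mono (Finsupp.single_mono (by omega)) hg
  have hmem := sub_mem hf hg'
  -- Otherwise `f` itself would lie in `L((a - 1)Q)`, against its pole order; hence `f - g` has pole
  -- order exactly `a`.
  have hnot : f - g ∉ C.riemannRochSpace (Finsupp.single Q.pt (a - 1)) := fun h => by
    have hf' := add_mem h hg
    rw [sub_add_cancel, mem_riemannRochSpace_single hf0] at hf'
    have := hf'.1 hcoh
    omega
  have h0 : f - g ≠ 0 := fun h => hnot (h ▸ zero_mem _)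
  refine ⟨f - g, h0, ?_, hmem, ?_⟩
  · have h1 := (mem_riemannRochSpace_single h0).1 hmem
    by_contra hne
    refine hnot ((mem_riemannRochSpace_single h0).2 ⟨fun _ => ?_, h1.2⟩)
    have := h1.1 hcoh
    omega
  · change evalMap P (Finsupp.single Q.pt a) hG (⟨f, hf⟩ - ⟨g, hg'⟩) = 0
    rw [map_sub, sub_eq_zero]
    exact hgf.symm

end Codes

end SmoothProjectiveCurve

/-! ### The ideal property. -/

open SmoothProjectiveCurve in
theorem mainTheorem6 {F : Type u} [Field F] [Finite F] (C : SmoothProjectiveCurve F) (n : ℕ)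
    (P : Fin n → C.RationalPoint) (Q : C.RationalPoint) (hP : Function.Injective P)
    (hQ : ∀ i, P i ≠ Q) :
    IsSemigroupIdeal (SmoothProjectiveCurve.weierstrassSemigroup Q)
      ((SmoothProjectiveCurve.weierstrassSemigroup Q : Set ℕ) \
        SmoothProjectiveCurve.geometricNongaps P Q hQ) := by
  refine ⟨Set.sdiff_subset, ?_⟩
  rintro a ⟨haW, ha⟩ b hb
  refine ⟨add_mem haW hb, fun hab => onePointCode_ne_of_mem_geometricNongaps hab ?_⟩
  by_cases hcoh : Order.coheight Q.pt = 1
  · refine (onePointCode_mono hQ (by omega)).antisymm ?_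
    obtain ⟨f, hf0, hfa, hf⟩ := haW
    obtain ⟨g, hg0, hgb, hg⟩ := hb
    have hsupp (c : ℤ) (i : Fin n) : Finsupp.single Q.pt c (P i).pt = 0 :=
      Finsupp.single_eq_of_ne fun h => hQ i (RationalPoint.ext h)
    obtain ⟨h, hh0, hha, hh, hev⟩ := exists_evalMap_eq_zero hQ hcoh
      (onePointCode_eq_of_notMem_geometricNongaps ha).ge hf0 hfa
      ((mem_riemannRochSpace_single hf0).2 ⟨fun _ => hfa.ge, hf⟩) (hsupp a)
    have hgL : g ∈ C.riemannRochSpace (Finsupp.single Q.pt (b : ℤ)) :=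
      (mem_riemannRochSpace_single hg0).2 ⟨fun _ => hgb.ge, hg⟩
    have hmul : h * g ∈ C.riemannRochSpace (Finsupp.single Q.pt ((a + b : ℕ) : ℤ)) := by
      rw [Nat.cast_add, Finsupp.single_add]
      exact mul_mem_riemannRochSpace hh hgL
    -- The product `h * g` is the vanishing function of pole order `a + b` that rules out a jump
    -- there.
    refine onePointCode_le_of_evalMap_eq_zero hQ hcoh (mul_ne_zero hh0 hg0) ?_ hmul (hsupp _) ?_
    · rw [Scheme.ord_mul hh0 hg0, hha, hgb]
      push_cast
      ring
    · rw [evalMap_mul (hsupp a) (hsupp b) (hsupp _) hh hgL hmul, hev, zero_mul]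
  · exact onePointCode_eq_of_coheight_ne_one hQ hcoh _ _
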